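/- Let $\mathfrak S_n$ be the group of permutations of $\{1,\dots,n\}$, and for $\sigma\in\mathfrak S_n$ let $\#(\sigma)$ be the number of cycles of $\sigma$ (fixed points included). Let $\mathrm{LAS}(\sigma)$ be the length of the longest alternating subsequence of $\sigma$, i.e. the largest $k$ for which there are $i_1<i_2<\dots<i_k$ with $\sigma(i_1)>\sigma(i_2)<\sigma(i_3)>\cdots\sigma(i_k)$. For each $n\ge 1$ let $\sigma_n$ be a random permutation with values in $\mathfrak S_n$ (the $\sigma_n$ may live on different probability spaces). For $\alpha\ge 1$ say that $(\sigma_n)_{n\ge1}$ satisfies $\mathcal H^{\mathbb P}_{inv,\alpha}$ if it is conjugation invariant, i.e. $\tau^{-1}\sigma_n\tau$ has the same law as $\sigma_n$ for all $n\ge1$ and all $\tau\in\mathfrak S_n$, and $\#(\sigma_n)/n^{1/\alpha}\to 0$ in probability as $n\to\infty$. (i) If $(\sigma_n)_{n\ge1}$ satisfies $\mathcal H^{\mathbb P}_{inv,1}$, then $\mathrm{LAS}(\sigma_n)/n\to \frac23$ in probability, and $\mathbb E(\mathrm{LAS}(\sigma_n))=\frac23 n+o(n)$. (ii) If $(\sigma_n)_{n\ge1}$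 satisfies $\mathcal H^{\mathbb P}_{inv,2}$, then $\dfrac{\mathrm{LAS}(\sigma_n)-\frac23 n}{\sqrt n}$ converges in distribution to the normal law $\mathcal N\left(0,\frac{8}{45}\right)$ with mean $0$ and variance $\frac{8}{45}$. -/

import Mathlib

open MeasureTheory ProbabilityTheory Filter Topology Asymptotics

/-- The finite set of permutations of `n` letters carries the discrete σ-algebra. -/
instance permMeasurableSpace (n : ℕ) : MeasurableSpace (Equiv.Perm (Fin n)) := ⊤

/-- The number of cycles of `σ`, fixed points included (they are the parts equal to `1` of the
cycle partition). -/
def numCycles {n : ℕ} (σ : Equiv.Perm (Fin n)) : ℕ :=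
  Multiset.card σ.partition.parts

/-- `i 0 < i 1 < ⋯ < i (k-1)` are the positions of an alternating subsequence of `σ`:
`σ (i 0) > σ (i 1) < σ (i 2) > ⋯`. -/
def IsAlternatingSubseq {n k : ℕ} (σ : Equiv.Perm (Fin n)) (i : Fin k → Fin n) : Prop :=
  StrictMono i ∧ ∀ j l : Fin k, (l : ℕ) = j + 1 →
    (Even (j : ℕ) → σ (i l) < σ (i j)) ∧ (¬ Even (j : ℕ) → σ (i j) < σ (i l))

/-- The length of the longest alternating subsequence of `σ`. -/
noncomputable def las {n : ℕ} (σ : Equiv.Perm (Fin n)) : ℕ :=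
  sSup {k : ℕ | ∃ i : Fin k → Fin n, IsAlternatingSubseq σ i}

/-- The supremum defining `las` is a maximum. -/
theorem las_isGreatest {n : ℕ} (σ : Equiv.Perm (Fin n)) :
    IsGreatest {k : ℕ | ∃ i : Fin k → Fin n, IsAlternatingSubseq σ i} (las σ) := by
  have hb : BddAbove {k : ℕ | ∃ i : Fin k → Fin n, IsAlternatingSubseq σ i} := by
    refine ⟨n, ?_⟩
    rintro k ⟨i, hi, -⟩
    simpa using Fintype.card_le_of_injective i hi.injective
  have hne : {k : ℕ | ∃ i : Fin k → Fin n, IsAlternatingSubseq σ i}.Nonempty :=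
    ⟨0, Fin.elim0, fun a => a.elim0, fun a => a.elim0⟩
  exact ⟨Nat.sSup_mem hne hb, fun k hk => le_csSup hb hk⟩

/-- Convergence in probability to a constant of real random variables `X n`, each defined on its
own probability space. -/
def TendstoInProb {Ω : ℕ → Type*} [∀ n, MeasurableSpace (Ω n)] (P : ∀ n, Measure (Ω n))
    (X : ∀ n, Ω n → ℝ) (c : ℝ) : Prop :=
  ∀ ε : ℝ, 0 < ε → Tendsto (fun n => P n {ω | ε ≤ |X n ω - c|}) atTop (𝓝 0)

/-- The law of `σ n` is invariant under conjugation, for every `n`. -/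
def ConjInvariant {Ω : ℕ → Type*} [∀ n, MeasurableSpace (Ω n)] (P : ∀ n, Measure (Ω n))
    (σ : ∀ n, Ω n → Equiv.Perm (Fin n)) : Prop :=
  ∀ n, ∀ τ : Equiv.Perm (Fin n),
    IdentDistrib (σ n) (fun ω => τ⁻¹ * σ n ω * τ) (P n) (P n)

/-- Conjugation invariant random permutations with few cycles: `#(σ n) / n ^ (1/α)` tends to `0`
in probability. -/
def HInv {Ω : ℕ → Type*} [∀ n, MeasurableSpace (Ω n)] (α : ℝ) (P : ∀ n, Measure (Ω n))
    (σ : ∀ n, Ω n → Equiv.Perm (Fin n)) : Prop :=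
  ConjInvariant P σ ∧
    TendstoInProb P (fun n ω => (numCycles (σ n ω) : ℝ) / (n : ℝ) ^ (1 / α)) 0

/-!
The proof replaces the given random permutation by a uniform one and treats the uniform case
through a Markov chain.

*Reduction to the uniform law.* Changing one value of a permutation changes `las` by at most three
(`abs_las_sub_las_le`). Every permutation `ρ` becomes a cyclic one after changing at most
`2 * numCycles ρ` of its values (`exists_numCycles_eq_one`). Conjugating both by a uniform `τ` keeps
the number of changes; it turns a permutation with a conjugation invariant law into one with the
same law, and the cyclic permutation into a uniform cyclic one, whatever `ρ` was. Hence the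
expectation of a bounded Lipschitz function of `las` under any conjugation invariant law is close
to that under the uniform law on cyclic permutations if there are few cycles. The uniform law on all
permutations is itself conjugation invariant with the harmonic number as its mean number of cycles,
so it can serve as the reference (`HInv.tendsto_integral_sub_uniformMean`).

*The uniform law.* The length `las ρ` is the number of turns of the walk through `0` followed by the
one-line notation of `ρ`, entered downwards (`las_eq_turns`). Among the `n + 1` positions at which a
new largest value can be inserted, exactly `las ρ` create no turn and exactly one creates a single
turn; all others create two (`sum_turns_insertIdx`). So under the uniform laws
`las` behaves like a Markov chain whose drift is affine (`uniformMean_las_succ`), and with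
`Y = las - (4 n + 1) / 6` the product `n (n - 1) Y` is a martingale. The second moment of `Y` is at
most `n + 1` (`uniformMean_sq_centred_le`), which is the law of large numbers. The
conditional variance of an increment of `las` differs from `8 / 9` only by terms that are small in
the mean, so the characteristic function of the martingale is, up to errors whose sum tends
to zero, a product of Gaussian factors (`norm_martingaleCharFun_succ_sub_le`); the variance is
`8 / 9 * ∑ k < n, (k (k + 1)) ^ 2 / n ^ 5 → 8 / 45`, relative to `n`.
-/

/-! ### Alternating subsequences as turns -/

/-- The number of times the walk through the list `l`, entered from the value `p` in the direction
`d` (`true` for up, `false` for down), changes its direction. A step to an equal value counts as a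
step down. -/
def turns : Bool → ℕ → List ℕ → ℕ
  | _, _, [] => 0
  | d, p, x :: l => (if d = decide (p < x) then 0 else 1) + turns (decide (p < x)) x l

/-- Consecutive entries of the list alternate, the first step being down if `d = true` and up if
`d = false`. -/
def IsAlternatingList : Bool → List ℕ → Prop
  | _, [] => True
  | _, [_] => True
  | d, a :: b :: l => (if d then b < a else a < b) ∧ IsAlternatingList (!d) (b :: l)

theorem turns_le_length (d : Bool) (p : ℕ) (l : List ℕ) : turns d p l ≤ l.length := by
  induction l generalizing d p with
  | nil => simp [turns]
  | cons x l ih =>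
    have := ih (decide (p < x)) x
    simp only [turns, List.length_cons]
    split_ifs <;> omega

theorem turns_le_turns_succ (d d' : Bool) (p : ℕ) (l : List ℕ) :
    turns d p l ≤ turns d' p l + 1 := by
  cases l with
  | nil => simp [turns]
  | cons x l =>
    simp only [turns]
    split_ifs <;> omega

theorem turns_le_turns_add_two (d d' : Bool) (p q : ℕ) (l : List ℕ) :
    turns d p l ≤ turns d' q l + 2 := by
  cases l with
  | nil => simp [turns]
  | cons x l =>
    have := turns_le_turns_succ (decide (p < x)) (decide (q < x)) x l
    simp only [turns]
    split_ifs <;> omega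

/-- A walk cannot be outpaced by an alternating sublist: this is the upper bound in the description
of the longest alternating subsequence by the turns of the walk. -/
theorem IsAlternatingList.length_le_turns {d : Bool} {p q : ℕ} {l s : List ℕ}
    (h : s.Sublist l) (ha : IsAlternatingList d (q :: s)) (hq : if d then q ≤ p else p ≤ q) :
    s.length ≤ turns d p l := by
  induction l generalizing d p q s with
  | nil => simp_all
  | cons x l ih =>
    have h1 := turns_le_turns_succ true false x l
    have h2 := turns_le_turns_succ false true x l
    cases h with
    | cons_cons _ h =>
      rename_i s
      have hs := ih h ha.2 (p := x) (by simp)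
      have hx := ha.1
      cases d
      · have : p < x := by simp at hx hq; omega
        simp [turns, this] at hs ⊢; omega
      · have : ¬ p < x := by simp at hx hq; omega
        simp [turns, this] at hs ⊢; omega
    | cons _ h =>
      cases d
      · by_cases hpx : p < x
        · simp only [turns, hpx, decide_true, Bool.false_eq_true, if_false]
          by_cases hqx : x ≤ q
          · have := ih h ha (p := x) (by simpa using hqx)
            omega
          cases s with
          | nil => simp
          | cons y s =>
            by_cases hy : y ≤ x
            · have := ih ((List.sublist_cons_self _ _).trans h) ha.2 (p := x) (by simpa using hy)
              simp at this ⊢; omega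
            · have := ih h (d := false) (q := x) (p := x) ⟨by simpa using hy, ha.2⟩ (by simp)
              omega
        · simp only [turns, hpx, decide_false, if_true, zero_add]
          exact ih h ha (by simp at hq ⊢; omega)
      · by_cases hpx : p < x
        · simp only [turns, hpx, decide_true, if_true, zero_add]
          exact ih h ha (by simp at hq ⊢; omega)
        · simp only [turns, hpx, decide_false, Bool.true_eq_false, if_false]
          by_cases hqx : q ≤ x
          · have := ih h ha (p := x) (by simpa using hqx)
            omega
          cases s with
          | nil => simp
          | cons y s =>
            by_cases hy : x ≤ y
            · have := ih ((List.sublist_cons_self _ _).trans h) ha.2 (p := x) (by simpa using hy)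
              simp at this ⊢; omega
            · have := ih h (d := true) (q := x) (p := x) ⟨by simpa using hy, ha.2⟩ (by simp)
              omega

/-- The points at which the walk turns, followed by its end point, form an alternating sublist: this
is the lower bound. -/
theorem exists_isAlternatingList (d : Bool) (p : ℕ) (l : List ℕ)
    (hl : (p :: l).Pairwise (· ≠ ·)) :
    ∃ q s, (q :: s).Sublist (p :: l) ∧ IsAlternatingList d (q :: s) ∧
      (if d then p ≤ q else q ≤ p) ∧ s.length = turns d p l := by
  induction l generalizing d p with
  | nil => exact ⟨p, [], List.Sublist.refl _, trivial, by split_ifs <;> rfl, rfl⟩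
  | cons x l ih =>
    have hpx : p ≠ x := by simp at hl; tauto
    obtain ⟨q, s, hs, ha, hq, hlen⟩ := ih (decide (p < x)) x (List.pairwise_cons.1 hl).2
    by_cases hd : d = decide (p < x)
    · refine ⟨q, s, hs.trans (List.sublist_cons_self _ _), hd ▸ ha, ?_, ?_⟩
      · subst hd
        by_cases h : p < x <;> simp [h] at hq ⊢ <;> omega
      · simp [turns, hd, hlen]
    · refine ⟨p, q :: s, List.cons_sublist_cons.2 hs, ?_, ?_, ?_⟩
      -- The walk turns at `p`, so `p` is prepended.
      · have hd' : (!d) = decide (p < x) := by cases d <;> simp_all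
        refine ⟨?_, hd' ▸ ha⟩
        by_cases h : p < x <;> cases d <;> simp_all <;> omega
      · simp
      · simp [turns, hd, hlen]; omega

/-- The insertion of a value `M` exceeding all others into a walk: `f` is summed over all positions
of `M`. Entered downwards, the walk with `R` turns has exactly `R` positions that
create no turn and one position that creates one turn; all others create two. Entered upwards, one
more position creates no turn if the first step goes up. -/
theorem sum_turns_insertIdx_aux {E : Type*} [AddCommGroup E] [Module ℝ E] {M : ℕ} (l : List ℕ)
    (f : ℕ → E) (p : ℕ) (hp : p < M) (hl : ∀ x ∈ l, x < M) :
    (∑ i ∈ Finset.range (l.length + 1), f (turns false p (l.insertIdx i M)) =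
      (turns false p l : ℝ) • f (turns false p l) + f (turns false p l + 1) +
        ((l.length : ℝ) - turns false p l) • f (turns false p l + 2)) ∧
    (∀ y l', l = y :: l' →
      ∑ i ∈ Finset.range (l.length + 1), f (turns true p (l.insertIdx i M)) =
      ((turns true p l : ℝ) + if p < y then 1 else 0) • f (turns true p l) +
        f (turns true p l + 1) +
        ((l.length : ℝ) - turns true p l - if p < y then 1 else 0) • f (turns true p l + 2)) := by
  induction l generalizing f p with
  | nil => simp [turns, hp]
  | cons x l ih =>
    have hx : x < M := hl x (by simp)
    have hx' : ¬ M < x := by omega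
    have key : ∀ (d d' : Bool) (δ : ℕ), d' = decide (p < x) → δ = (if d = d' then 0 else 1) →
        ∑ i ∈ Finset.range ((x :: l).length + 1), f (turns d p ((x :: l).insertIdx i M)) =
        ∑ i ∈ Finset.range (l.length + 1), f (turns d' x (l.insertIdx i M) + δ) +
          f ((if d = true then 0 else 1) + (1 + turns false x l)) := by
      rintro d _ _ rfl rfl
      rw [List.length_cons, Finset.sum_range_succ']
      simp [turns, hp, hx', add_comm]
    obtain ⟨ih1, ih2⟩ := ih f x hx (fun y hy => hl y (by simp [hy]))
    obtain ⟨ih3, ih4⟩ := ih (fun k => f (k + 1)) x hx (fun y hy => hl y (by simp [hy]))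
    have e1 : ∀ A, 1 + A = A + 1 := fun A => add_comm 1 A
    have e2 : ∀ A, 1 + (A + 1) = A + 2 := fun A => by ring
    refine ⟨?_, ?_⟩
    · by_cases h : p < x
      · rw [key false true 1 (by simp [h]) (by simp)]
        cases l with
        | nil => simp [turns, h, hx, add_comm]
        | cons y l =>
          rw [ih4 _ _ rfl]
          by_cases hy : x < y <;> simp [turns, h, hy, e1, e2, add_assoc] <;> module
      · rw [key false false 0 (by simp [h]) (by simp)]
        simp only [add_zero, ih1]
        cases l with
        | nil => simp [turns, h, add_comm]
        | cons y l =>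
          by_cases hy : x < y <;> simp [turns, h, hy, e1, e2, add_assoc] <;> module
    · rintro y' l' ⟨rfl, rfl⟩
      by_cases h : p < x
      · rw [key true true 0 (by simp [h]) (by simp)]
        cases l with
        | nil => simp [turns, h, hx]
        | cons y l =>
          simp only [add_zero, ih2 _ _ rfl]
          by_cases hy : x < y <;> simp [turns, h, hy, e1, e2, add_assoc] <;> module
      · rw [key true false 1 (by simp [h]) (by simp), ih3]
        cases l with
        | nil => simp [turns, h, add_comm]
        | cons y l =>
          by_cases hy : x < y <;> simp [turns, h, hy, e1, e2, add_assoc] <;> module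

theorem sum_turns_insertIdx {E : Type*} [AddCommGroup E] [Module ℝ E] {M : ℕ} (l : List ℕ)
    (f : ℕ → E) (p : ℕ) (hp : p < M) (hl : ∀ x ∈ l, x < M) :
    ∑ i ∈ Finset.range (l.length + 1), f (turns false p (l.insertIdx i M)) =
      (turns false p l : ℝ) • f (turns false p l) + f (turns false p l + 1) +
        ((l.length : ℝ) - turns false p l) • f (turns false p l + 2) :=
  (sum_turns_insertIdx_aux l f p hp hl).1

theorem isAlternatingList_iff {d : Bool} {l : List ℕ} :
    IsAlternatingList d l ↔ ∀ (j : ℕ) (h : j + 1 < l.length),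
      if d = decide (Even j) then l[j + 1] < l[j] else l[j] < l[j + 1] := by
  induction l generalizing d with
  | nil => simp [IsAlternatingList]
  | cons a l ih =>
    cases l with
    | nil => simp [IsAlternatingList]
    | cons b l =>
      simp only [IsAlternatingList, ih]
      constructor
      · rintro ⟨h0, h⟩ (_ | j) hj
        · simpa using h0
        · have := h j (by simpa using hj)
          cases d <;> by_cases hj : Even j <;> simpa [hj, Nat.even_add_one] using this
      · refine fun h => ⟨by simpa using h 0 (by simp), fun j hj => ?_⟩
        have := h (j + 1) (by simpa using hj)
        cases d <;> by_cases hj : Even j <;> simpa [hj, Nat.even_add_one] using this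

/-- The one-line notation of `σ`, with values starting at `1`. -/
def oneLine {n : ℕ} (σ : Equiv.Perm (Fin n)) : List ℕ :=
  List.ofFn fun i => (σ i : ℕ) + 1

theorem isAlternatingSubseq_iff {n k : ℕ} {σ : Equiv.Perm (Fin n)} {i : Fin k → Fin n}
    (hi : StrictMono i) :
    IsAlternatingSubseq σ i ↔
      IsAlternatingList true (List.ofFn fun j => (σ (i j) : ℕ) + 1) := by
  rw [isAlternatingList_iff, IsAlternatingSubseq, and_iff_right hi]
  constructor
  · intro h j hj
    simp at hj
    have := h ⟨j, by omega⟩ ⟨j + 1, hj⟩ rfl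
    by_cases hj : Even j <;> simpa [hj] using this
  · rintro h ⟨j, hj⟩ ⟨l, hl⟩ rfl
    have := h j (by simpa using hl)
    by_cases hj : Even j <;> simpa [hj] using this

/-- A longest alternating subsequence has as many terms as the walk through the one-line notation
has turns, when it is entered downwards from a value below all others. -/
theorem las_eq_turns {n : ℕ} (σ : Equiv.Perm (Fin n)) : las σ = turns false 0 (oneLine σ) := by
  have hg := las_isGreatest σ
  apply le_antisymm
  · obtain ⟨i, hi⟩ := hg.1
    have h := (isAlternatingSubseq_iff hi.1).1 hi
    have hsub : (List.ofFn fun j => (σ (i j) : ℕ) + 1).Sublist (oneLine σ) := by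
      rw [List.sublist_iff_exists_fin_orderEmbedding_get_eq]
      refine ⟨((Fin.castOrderIso (by simp)).toOrderEmbedding.trans
        (OrderEmbedding.ofStrictMono i hi.1)).trans
          (Fin.castOrderIso (by simp [oneLine])).toOrderEmbedding, fun j => ?_⟩
      simp [oneLine]
      rfl
    have h' : IsAlternatingList false (0 :: List.ofFn fun j => (σ (i j) : ℕ) + 1) := by
      generalize las σ = k at *
      cases k with
      | zero => simp [IsAlternatingList]
      | succ k =>
        rw [List.ofFn_succ] at h ⊢
        exact ⟨by simp, h⟩
    simpa using h'.length_le_turns hsub (p := 0) (by simp)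
  · obtain ⟨q, s, hs, ha, hq, hlen⟩ := exists_isAlternatingList false 0 (oneLine σ) (by
      rw [List.pairwise_cons]
      refine ⟨by simp [oneLine, List.mem_ofFn], ?_⟩
      rw [← List.Nodup, oneLine, List.nodup_ofFn]
      intro a b h
      simpa [Fin.val_inj] using h)
    obtain rfl : q = 0 := by simpa using hq
    have hs' : IsAlternatingList true s := by
      cases s with
      | nil => trivial
      | cons y s => exact ha.2
    obtain ⟨e, he⟩ := List.sublist_iff_exists_fin_orderEmbedding_get_eq.1
      (List.cons_sublist_cons.1 hs)
    have hmono : StrictMono fun j => Fin.cast (by simp [oneLine] : (oneLine σ).length = n) (e j) :=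
      fun a b h => e.strictMono h
    rw [← hlen]
    refine hg.2 ⟨_, (isAlternatingSubseq_iff hmono).2 ?_⟩
    convert hs'
    refine List.ext_get (by simp) fun j h1 h2 => ?_
    rw [he ⟨j, h2⟩]
    simp [oneLine]
    rfl

theorem turns_ofFn_le {n : ℕ} (d : Bool) (p : ℕ) (v w : Fin n → ℕ) :
    turns d p (List.ofFn v) ≤ turns d p (List.ofFn w) + 3 * hammingDist v w := by
  induction n generalizing d p with
  | zero => simp
  | succ n ih =>
    have hd : hammingDist v w = (if v 0 ≠ w 0 then 1 else 0) +
        hammingDist (fun i : Fin n => v i.succ) (fun i => w i.succ) := by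
      simp only [hammingDist, Fin.card_filter_univ_succ]
      split_ifs <;> simp [add_comm]
    rw [List.ofFn_succ, List.ofFn_succ, hd]
    simp only [turns]
    have h1 := turns_le_turns_add_two (decide (p < v 0)) (decide (p < w 0)) (v 0) (w 0)
      (List.ofFn fun i => v i.succ)
    have h2 := ih (decide (p < w 0)) (w 0) (fun i => v i.succ) (fun i => w i.succ)
    by_cases h : v 0 = w 0
    · simp only [h] at h2 ⊢
      simp; omega
    · simp only [h, ne_eq, not_false_eq_true, if_true]
      split_ifs <;> omega

/-- Changing one value of a permutation creates or destroys at most three turns. -/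
theorem las_le_las_add {n : ℕ} (σ ρ : Equiv.Perm (Fin n)) :
    las σ ≤ las ρ + 3 * hammingDist σ ρ := by
  rw [las_eq_turns, las_eq_turns]
  refine (turns_ofFn_le _ _ _ (fun i => (ρ i : ℕ) + 1)).trans ?_
  have : hammingDist (fun i => (σ i : ℕ) + 1) (fun i => (ρ i : ℕ) + 1) = hammingDist σ ρ := by
    simp [hammingDist, Fin.val_inj]
  rw [this]; rfl

theorem abs_las_sub_las_le {n : ℕ} (σ ρ : Equiv.Perm (Fin n)) :
    |(las σ : ℝ) - las ρ| ≤ 3 * hammingDist σ ρ := by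
  have h1 : (las σ : ℝ) ≤ las ρ + 3 * hammingDist σ ρ := mod_cast las_le_las_add σ ρ
  have h2 : (las ρ : ℝ) ≤ las σ + 3 * hammingDist σ ρ := by
    rw [hammingDist_comm]; exact mod_cast las_le_las_add ρ σ
  rw [abs_sub_le_iff]; constructor <;> linarith

theorem las_le {n : ℕ} (σ : Equiv.Perm (Fin n)) : las σ ≤ n := by
  rw [las_eq_turns]
  simpa [oneLine] using turns_le_length false 0 (oneLine σ)

/-! ### Inserting the largest value -/

theorem ofFn_insertNth {α : Type*} {n : ℕ} (p : Fin (n + 1)) (a : α) (v : Fin n → α) :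
    List.ofFn (p.insertNth a v : Fin (n + 1) → α) = (List.ofFn v).insertIdx p a := by
  induction n with
  | zero =>
    obtain rfl : p = 0 := by omega
    simp
  | succ n ih =>
    refine Fin.cases ?_ (fun q => ?_) p
    · simp
    · rw [← Fin.cons_self_tail v, Fin.insertNth_succ_cons, List.ofFn_cons, List.ofFn_cons,
        Fin.val_succ, List.insertIdx_succ_cons, ih]

/-- The permutation of `n + 1` letters obtained from `τ` by inserting the largest value at the
position `p`. -/
def insertMax {n : ℕ} (p : Fin (n + 1)) (τ : Equiv.Perm (Fin n)) : Equiv.Perm (Fin (n + 1)) :=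
  (finSuccEquiv' p).trans ((Equiv.optionCongr τ).trans (finSuccEquiv' (Fin.last n)).symm)

theorem insertMax_self {n : ℕ} (p : Fin (n + 1)) (τ : Equiv.Perm (Fin n)) :
    insertMax p τ p = Fin.last n := by
  simp [insertMax]

theorem insertMax_succAbove {n : ℕ} (p : Fin (n + 1)) (τ : Equiv.Perm (Fin n)) (i : Fin n) :
    insertMax p τ (p.succAbove i) = (τ i).castSucc := by
  simp [insertMax]

theorem oneLine_insertMax {n : ℕ} (p : Fin (n + 1)) (τ : Equiv.Perm (Fin n)) :
    oneLine (insertMax p τ) = (oneLine τ).insertIdx p (n + 1) := by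
  rw [oneLine, oneLine, ← ofFn_insertNth]
  congr 1
  rw [Fin.eq_insertNth_iff]
  refine ⟨by simp [insertMax_self], ?_⟩
  ext i
  simp [Fin.removeNth, insertMax_succAbove]

theorem bijective_insertMax (n : ℕ) :
    Function.Bijective fun x : Fin (n + 1) × Equiv.Perm (Fin n) => insertMax x.1 x.2 := by
  rw [Fintype.bijective_iff_injective_and_card]
  refine ⟨?_, by simp [Fintype.card_perm, Nat.factorial_succ]⟩
  rintro ⟨p, τ⟩ ⟨q, ρ⟩ h
  simp only at h
  have hpq : p = q := (insertMax p τ).injective (by rw [insertMax_self, h, insertMax_self])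
  subst hpq
  congr 1
  ext i
  have := insertMax_succAbove p τ i
  rw [h, insertMax_succAbove] at this
  simpa [Fin.ext_iff, eq_comm] using this

/-- Inserting the largest value at a uniform position makes the longest alternating subsequence a
Markov chain. -/
theorem sum_las_succ {E : Type*} [AddCommGroup E] [Module ℝ E] (n : ℕ) (f : ℕ → E) :
    ∑ σ : Equiv.Perm (Fin (n + 1)), f (las σ) =
      ∑ τ : Equiv.Perm (Fin n), ((las τ : ℝ) • f (las τ) + f (las τ + 1) +
        ((n : ℝ) - las τ) • f (las τ + 2)) := by
  rw [← (bijective_insertMax n).sum_comp (fun σ => f (las σ)), Fintype.sum_prod_type_right]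
  refine Finset.sum_congr rfl fun τ _ => ?_
  have h := sum_turns_insertIdx (M := n + 1) (oneLine τ) f 0 (by simp)
    (by simp [oneLine, List.mem_ofFn])
  have hlen : (oneLine τ).length = n := by simp [oneLine]
  rw [hlen, Finset.sum_range] at h
  simpa only [las_eq_turns, oneLine_insertMax] using h

/-! ### Cycles -/

section
open Equiv Equiv.Perm

/-- Cutting the point `x` out of its cycle turns it into a fixed point, so the number of cycles,
fixed points included, grows by one. -/
theorem card_cycleType_swap_mul {α : Type*} [Fintype α] [DecidableEq α] (σ : Perm α) {x : α}
    (hx : σ x ≠ x) :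
    Multiset.card (swap x (σ x) * σ).cycleType + σ.support.card =
      Multiset.card σ.cycleType + (swap x (σ x) * σ).support.card + 1 := by
  have hc : (σ.cycleOf x).IsCycle := isCycle_cycleOf σ hx
  have hmem : σ.cycleOf x ∈ σ.cycleFactorsFinset := cycleOf_mem_cycleFactorsFinset_iff.2 (by simpa)
  have hd := (disjoint_mul_inv_of_mem_cycleFactorsFinset hmem).symm
  have hcx : σ.cycleOf x x = σ x := cycleOf_apply_self σ x
  generalize σ.cycleOf x = c at *
  obtain ⟨r, rfl⟩ : ∃ r, σ = c * r := ⟨c⁻¹ * σ, by simp⟩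
  have hr : c * r * c⁻¹ = r := by
    have := hd.commute.eq
    rw [inv_mul_cancel_right] at this
    rw [← mul_left_cancel_iff (a := c), this]
  rw [hr] at hd
  rw [← hcx] at hx ⊢
  have hd' : Disjoint (swap x (c x) * c) r := by
    refine disjoint_iff_disjoint_support.2 (disjoint_iff_disjoint_support.1 hd |>.mono_left ?_)
    exact fun y hy => (mem_support_swap_mul_imp_mem_support_ne hy).1
  rw [← mul_assoc, hd.cycleType_mul, hd'.cycleType_mul, hd.card_support_mul, hd'.card_support_mul,
    Multiset.card_add, Multiset.card_add, card_cycleType_eq_one.2 hc]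
  by_cases hcc : c (c x) = x
  · have h := hc.eq_swap_of_apply_apply_eq_self hx hcc
    have h1 : swap x (c x) * c = 1 := by
      nth_rw 2 [h]
      exact swap_mul_self _ _
    have h2 : c.support.card = 2 := by
      rw [h, card_support_swap hx.symm]
    rw [h1, h2]; simp; omega
  · rw [card_cycleType_eq_one.2 (hc.swap_mul hx hcc), support_swap_mul_eq c x hcc,
      Finset.card_sdiff_of_subset (by simpa using hx)]
    have := Finset.card_pos.2 ⟨x, mem_support.2 hx⟩
    simp; omega

theorem numCycles_eq {n : ℕ} (σ : Perm (Fin n)) :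
    (numCycles σ : ℤ) = Multiset.card σ.cycleType + n - σ.support.card := by
  have : σ.support.card ≤ n := by simpa using σ.support.card_le_univ
  rw [numCycles, parts_partition]
  simp
  omega

theorem decomposeFin_symm_eq_swap_mul {n : ℕ} (p : Fin (n + 1)) (e : Perm (Fin n)) :
    decomposeFin.symm (p, e) = swap 0 p * decomposeFin.symm (0, e) := by
  ext i
  refine Fin.cases ?_ (fun i => ?_) i <;> simp

theorem decomposeFin_symm_zero {n : ℕ} (e : Perm (Fin n)) :
    decomposeFin.symm (0, e) = e.extendDomain (finSuccAboveEquiv 0) := by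
  ext i
  refine Fin.cases ?_ (fun i => ?_) i
  · simp [extendDomain_apply_not_subtype]
  · have : e.extendDomain (finSuccAboveEquiv 0) i.succ = (e i).succ :=
      extendDomain_apply_image e (finSuccAboveEquiv (0 : Fin (n + 1))) i
    simp [this]

/-- Putting the point `0` in front of `p` in its cycle keeps the number of cycles; leaving it fixed
adds a cycle. -/
theorem numCycles_decomposeFin_symm {n : ℕ} (p : Fin (n + 1)) (e : Perm (Fin n)) :
    numCycles (decomposeFin.symm (p, e)) = numCycles e + if p = 0 then 1 else 0 := by
  have h0 : numCycles (decomposeFin.symm ((0 : Fin (n + 1)), e)) = numCycles e + 1 := by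
    have h1 := numCycles_eq (decomposeFin.symm ((0 : Fin (n + 1)), e))
    have h2 := numCycles_eq e
    rw [decomposeFin_symm_zero, cycleType_extendDomain, card_support_extend_domain] at h1
    rw [decomposeFin_symm_zero]
    push_cast at h1
    omega
  by_cases hp : p = 0
  · simp [hp, h0]
  · have h1 := numCycles_eq (decomposeFin.symm ((0 : Fin (n + 1)), e))
    have h2 := numCycles_eq (decomposeFin.symm (p, e))
    have h3 := card_cycleType_swap_mul (decomposeFin.symm (p, e)) (x := 0) (by simpa using hp)
    rw [decomposeFin_symm_apply_zero] at h3
    have h4 : swap 0 p * decomposeFin.symm (p, e) = decomposeFin.symm (0, e) := by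
      rw [decomposeFin_symm_eq_swap_mul, swap_mul_self_mul]
    rw [h4] at h3
    simp only [hp, if_false]
    omega

theorem hammingDist_swap_mul_le {n : ℕ} (a b : Fin n) (σ : Perm (Fin n)) :
    hammingDist σ (swap a b * σ : Perm (Fin n)) ≤ 2 := by
  refine (Finset.card_le_card (t := {σ⁻¹ a, σ⁻¹ b}) fun i hi => ?_).trans Finset.card_le_two
  by_contra h
  simp only [Finset.mem_insert, Finset.mem_singleton, eq_inv_iff_eq, not_or] at h
  exact (Finset.mem_filter.1 hi).2 (swap_apply_of_ne_of_ne h.1 h.2).symm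

theorem hammingDist_decomposeFin_symm {n : ℕ} (p : Fin (n + 1)) (e c : Perm (Fin n)) :
    hammingDist (decomposeFin.symm (p, e)) (decomposeFin.symm (p, c)) = hammingDist e c := by
  simp only [hammingDist, Fin.card_filter_univ_succ]
  simp

/-- Every permutation is close to a cyclic one: its cycles are merged by changing at most two values
per cycle. -/
theorem exists_numCycles_eq_one {n : ℕ} (hn : 1 ≤ n) (σ : Perm (Fin n)) :
    ∃ c : Perm (Fin n), numCycles c = 1 ∧ hammingDist σ c ≤ 2 * numCycles σ := by
  induction n, hn using Nat.le_induction with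
  | base =>
    refine ⟨σ, ?_, by simp⟩
    have h0 : numCycles (default : Perm (Fin 0)) = 0 := by
      have := numCycles_eq (default : Perm (Fin 0))
      simp at this
      simpa using this
    have h1 := numCycles_decomposeFin_symm (0 : Fin 1) default
    rw [h0, if_pos rfl, zero_add] at h1
    rwa [Subsingleton.elim σ (decomposeFin.symm (0, default))]
  | succ n hn ih =>
    obtain ⟨⟨p, e⟩, rfl⟩ := decomposeFin.symm.surjective σ
    obtain ⟨c, hc, hd⟩ := ih e
    by_cases hp : p = 0
    · subst hp
      have hl : Fin.last n ≠ 0 := by simp [Fin.ext_iff]; omega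
      refine ⟨decomposeFin.symm (Fin.last n, c), ?_, ?_⟩
      · simp [numCycles_decomposeFin_symm, hc, hl]
      · have h1 := hammingDist_triangle (⇑(decomposeFin.symm ((0 : Fin (n + 1)), e)))
          (decomposeFin.symm ((0 : Fin (n + 1)), c)) (decomposeFin.symm (Fin.last n, c))
        have h2 := hammingDist_swap_mul_le 0 (Fin.last n) (decomposeFin.symm (0, c))
        rw [← decomposeFin_symm_eq_swap_mul] at h2
        rw [hammingDist_decomposeFin_symm] at h1
        simp only [numCycles_decomposeFin_symm, if_true]
        omega
    · refine ⟨decomposeFin.symm (p, c), ?_, ?_⟩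
      · simp [numCycles_decomposeFin_symm, hc, hp]
      · simpa [hammingDist_decomposeFin_symm, numCycles_decomposeFin_symm, hp] using hd

theorem isConj_of_numCycles_eq_one {n : ℕ} {c d : Perm (Fin n)} (hc : numCycles c = 1)
    (hd : numCycles d = 1) : IsConj c d := by
  rw [partition_eq_of_isConj, Nat.Partition.ext_iff]
  obtain ⟨a, ha⟩ := Multiset.card_eq_one.1 hc
  obtain ⟨b, hb⟩ := Multiset.card_eq_one.1 hd
  have h1 := c.partition.parts_sum
  have h2 := d.partition.parts_sum
  simp only [ha, hb, Multiset.sum_singleton] at *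
  rw [h1, h2]

theorem hammingDist_conj {n : ℕ} (τ σ c : Perm (Fin n)) :
    hammingDist (τ * σ * τ⁻¹ : Perm (Fin n)) (τ * c * τ⁻¹ : Perm (Fin n)) = hammingDist σ c := by
  refine Finset.card_nbij' (τ⁻¹ ·) (τ ·) ?_ ?_ ?_ ?_ <;> intro i <;> simp

theorem sum_numCycles_succ (n : ℕ) :
    ∑ σ : Perm (Fin (n + 1)), (numCycles σ : ℝ) =
      (n + 1) * ∑ σ : Perm (Fin n), (numCycles σ : ℝ) + n.factorial := by
  rw [← decomposeFin.symm.sum_comp, Fintype.sum_prod_type_right, Finset.mul_sum]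
  simp only [numCycles_decomposeFin_symm]
  simp [Finset.sum_add_distrib, Fintype.card_perm]

end

/-- The expectation of `g` under the uniform distribution on the permutations of `n` letters. -/
noncomputable def uniformMean {E : Type*} [AddCommGroup E] [Module ℝ E] (n : ℕ)
    (g : Equiv.Perm (Fin n) → E) : E :=
  (n.factorial : ℝ)⁻¹ • ∑ σ, g σ

theorem uniformMean_numCycles (n : ℕ) :
    uniformMean n (fun σ => (numCycles σ : ℝ)) = harmonic n := by
  induction n with
  | zero =>
    have := numCycles_eq (default : Equiv.Perm (Fin 0))
    simp at this
    simp [uniformMean, this]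
  | succ n ih =>
    rw [uniformMean, sum_numCycles_succ, harmonic_succ, Rat.cast_add, ← ih, uniformMean]
    have : (n.factorial : ℝ) ≠ 0 := by positivity
    push_cast [Nat.factorial_succ]
    simp only [smul_eq_mul]
    field_simp

/-! ### Uniform means -/

section
variable {E : Type*} [NormedAddCommGroup E] [NormedSpace ℝ E] {n : ℕ}

theorem uniformMean_const (c : E) : uniformMean n (fun _ => c) = c := by
  have : (n.factorial : ℝ) ≠ 0 := by positivity
  simp [uniformMean, Fintype.card_perm, ← Nat.cast_smul_eq_nsmul ℝ, smul_smul, this]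

theorem uniformMean_add (g h : Equiv.Perm (Fin n) → E) :
    uniformMean n (fun σ => g σ + h σ) = uniformMean n g + uniformMean n h := by
  simp [uniformMean, Finset.sum_add_distrib]

theorem uniformMean_sub (g h : Equiv.Perm (Fin n) → E) :
    uniformMean n (fun σ => g σ - h σ) = uniformMean n g - uniformMean n h := by
  simp [uniformMean, Finset.sum_sub_distrib, smul_sub]

theorem uniformMean_const_mul (c : ℝ) (g : Equiv.Perm (Fin n) → ℝ) :
    uniformMean n (fun σ => c * g σ) = c * uniformMean n g := by
  simp only [uniformMean, ← Finset.mul_sum, smul_eq_mul]; ring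

theorem uniformMean_complex_const_mul (c : ℂ) (g : Equiv.Perm (Fin n) → ℂ) :
    uniformMean n (fun σ => c * g σ) = c * uniformMean n g := by
  simp [uniformMean, ← Finset.mul_sum]; ring

theorem uniformMean_mono {g h : Equiv.Perm (Fin n) → ℝ} (H : ∀ σ, g σ ≤ h σ) :
    uniformMean n g ≤ uniformMean n h :=
  mul_le_mul_of_nonneg_left (Finset.sum_le_sum fun σ _ => H σ) (by positivity)

theorem norm_uniformMean_le (g : Equiv.Perm (Fin n) → E) :
    ‖uniformMean n g‖ ≤ uniformMean n fun σ => ‖g σ‖ := by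
  rw [uniformMean, uniformMean, norm_smul, Real.norm_of_nonneg (by positivity)]
  exact mul_le_mul_of_nonneg_left (norm_sum_le _ _) (by positivity)

/-- The transition of the Markov chain `las`: a longest alternating subsequence of length `L` among
`n` letters keeps its length with probability `L / (n + 1)` and grows by one with
probability `1 / (n + 1)` when the largest value is inserted, and otherwise it grows by two. -/
theorem uniformMean_las_succ (n : ℕ) (f : ℕ → E) :
    uniformMean (n + 1) (fun σ => f (las σ)) =
      uniformMean n fun τ => ((las τ : ℝ) / (n + 1)) • f (las τ) +
        (1 / (n + 1) : ℝ) • f (las τ + 1) + (((n : ℝ) - las τ) / (n + 1)) • f (las τ + 2) := by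
  simp only [uniformMean, sum_las_succ, Nat.factorial_succ]
  have h1 : (n.factorial : ℝ) ≠ 0 := by positivity
  have h2 : (n + 1 : ℝ) ≠ 0 := by positivity
  rw [Finset.smul_sum, Finset.smul_sum]
  refine Finset.sum_congr rfl fun τ _ => ?_
  push_cast
  match_scalars <;> field_simp

end

/-! ### The centred length -/

/-- The length `L` of a longest alternating subsequence among `n` letters minus its uniform mean
`(4 n + 1) / 6` (which is the mean for `n ≥ 2`). -/
noncomputable def centred (n L : ℕ) : ℝ := L - (4 * n + 1) / 6

/-- One step of the chain multiplies the centred length by `(n - 1) / (n + 1)` in the mean and adds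
a conditional variance of at most one. -/
theorem sq_centred_step {n L : ℕ} (hL : L ≤ n) :
    (L : ℝ) / (n + 1) * centred (n + 1) L ^ 2 + 1 / (n + 1) * centred (n + 1) (L + 1) ^ 2 +
      ((n : ℝ) - L) / (n + 1) * centred (n + 1) (L + 2) ^ 2 ≤ centred n L ^ 2 + 1 := by
  have hn : (0 : ℝ) < n + 1 := by positivity
  have hL' : (L : ℝ) ≤ n := mod_cast hL
  have hn0 : (0 : ℝ) ≤ n := by positivity
  have key : (L : ℝ) / (n + 1) * centred (n + 1) L ^ 2 + 1 / (n + 1) * centred (n + 1) (L + 1) ^ 2 +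
      ((n : ℝ) - L) / (n + 1) * centred (n + 1) (L + 2) ^ 2 =
      centred n L ^ 2 * ((n - 1) / (n + 1)) ^ 2 + 1 - (1 - (2 * n + 1 - 2 * L) / (n + 1)) ^ 2
        - 1 / (n + 1) := by
    simp only [centred]
    push_cast
    field_simp
    ring
  rw [key]
  have h1 : (((n : ℝ) - 1) / (n + 1)) ^ 2 ≤ 1 := by
    rw [sq_le_one_iff_abs_le_one, abs_le]
    constructor
    · rw [le_div_iff₀ hn]; linarith
    · rw [div_le_iff₀ hn]; linarith
  have h2 : 0 ≤ 1 / ((n : ℝ) + 1) := by positivity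
  nlinarith [sq_nonneg (centred n L), sq_nonneg (1 - (2 * (n : ℝ) + 1 - 2 * L) / (n + 1))]

theorem uniformMean_sq_centred_le (n : ℕ) :
    uniformMean n (fun σ => centred n (las σ) ^ 2) ≤ n + 1 := by
  induction n with
  | zero =>
    have : ∀ σ : Equiv.Perm (Fin 0), centred 0 (las σ) ^ 2 ≤ 1 := fun σ => by
      have : las σ = 0 := by have := las_le σ; omega
      norm_num [centred, this]
    refine (uniformMean_mono this).trans ?_
    rw [uniformMean_const]; simp
  | succ n ih =>
    rw [uniformMean_las_succ n (fun L => centred (n + 1) L ^ 2)]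
    refine (uniformMean_mono fun τ => sq_centred_step (las_le τ)).trans ?_
    rw [uniformMean_add, uniformMean_const]
    push_cast
    linarith

theorem uniformMean_abs_centred_le (n : ℕ) :
    uniformMean n (fun σ => |centred n (las σ)|) ≤ √(n + 1) := by
  have hr : 0 < √((n : ℝ) + 1) := by positivity
  have hr2 : √((n : ℝ) + 1) ^ 2 = n + 1 := Real.sq_sqrt (by positivity)
  set r := √((n : ℝ) + 1)
  -- The bound on the second moment enters through the inequality of the two means.
  have h : ∀ y : ℝ, |y| ≤ 1 / (2 * r) * y ^ 2 + r / 2 := fun y => by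
    have : 1 / (2 * r) * y ^ 2 + r / 2 - |y| = (|y| - r) ^ 2 / (2 * r) := by
      rw [← sq_abs y]; field_simp; ring
    have : 0 ≤ (|y| - r) ^ 2 / (2 * r) := by positivity
    linarith
  refine (uniformMean_mono fun σ => h (centred n (las σ))).trans ?_
  rw [uniformMean_add, uniformMean_const_mul, uniformMean_const]
  have := mul_le_mul_of_nonneg_left (uniformMean_sq_centred_le n) (by positivity : 0 ≤ 1 / (2 * r))
  rw [← hr2] at this
  have e : 1 / (2 * r) * r ^ 2 = r / 2 := by field_simp
  linarith

/-! ### The characteristic function -/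

theorem norm_exp_mul_I_sub_le {u : ℝ} (hu : |u| ≤ 1) :
    ‖Complex.exp (u * Complex.I) - (1 + u * Complex.I - u ^ 2 / 2)‖ ≤ |u| ^ 3 / 4 := by
  have h := Complex.exp_bound (x := u * Complex.I) (by simpa using hu) (n := 3) (by norm_num)
  have e : ∑ m ∈ Finset.range 3, (u * Complex.I) ^ m / (m.factorial : ℂ) =
      1 + u * Complex.I - u ^ 2 / 2 := by
    simp [Finset.sum_range_succ, mul_pow]; ring
  rw [e] at h
  refine h.trans ?_
  simp [Nat.factorial]
  have : 0 ≤ |u| ^ 3 := by positivity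
  linarith

/-- One step of the chain multiplies the characteristic function at the frequency `θ`
by the Gaussian factor of variance `8 / 9`, up to an error governed by the fluctuation of the
conditional variance. Here `x` is the conditional mean of the increment. -/
theorem norm_charFun_step_le {n L : ℕ} (hL : L ≤ n) {θ : ℝ} (hθ : |θ| ≤ 1 / 2) {x : ℝ}
    (hx : x = (2 * n + 1 - 2 * L) / (n + 1)) :
    ‖((L / (n + 1) : ℝ) : ℂ) * Complex.exp ((θ * (0 - x) : ℝ) * Complex.I) +
      ((1 / (n + 1) : ℝ) : ℂ) * Complex.exp ((θ * (1 - x) : ℝ) * Complex.I) +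
      (((n - L) / (n + 1) : ℝ) : ℂ) * Complex.exp ((θ * (2 - x) : ℝ) * Complex.I) -
      (Real.exp (-(4 / 9 * θ ^ 2)) : ℝ)‖ ≤
    3 * |θ| ^ 3 + θ ^ 2 * (4 / (3 * (n + 1)) * |centred n L| +
      4 / (n + 1) ^ 2 * centred n L ^ 2 + 1 / (n + 1)) := by
  have hn : (0 : ℝ) < n + 1 := by positivity
  have hL' : (L : ℝ) ≤ n := mod_cast hL
  have hL0 : (0 : ℝ) ≤ L := by positivity
  have hx0 : 0 ≤ x := by rw [hx]; apply div_nonneg <;> linarith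
  have hx2 : x ≤ 2 := by rw [hx, div_le_iff₀ hn]; linarith
  have hp0 : (0 : ℝ) ≤ L / (n + 1) := by positivity
  have hp1 : (0 : ℝ) ≤ 1 / (n + 1) := by positivity
  have hp2 : (0 : ℝ) ≤ (n - L) / (n + 1) := div_nonneg (by linarith) hn.le
  have hsum : (L / (n + 1) : ℝ) + 1 / (n + 1) + (n - L) / (n + 1) = 1 := by field_simp; ring
  have hmean : (L / (n + 1) : ℝ) * (0 - x) + 1 / (n + 1) * (1 - x) + (n - L) / (n + 1) * (2 - x)
      = 0 := by rw [hx]; field_simp; ring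
  have hvar : (L / (n + 1) : ℝ) * (0 - x) ^ 2 + 1 / (n + 1) * (1 - x) ^ 2 +
      (n - L) / (n + 1) * (2 - x) ^ 2 = 8 / 9 - (4 / (3 * (n + 1)) * centred n L +
      4 / (n + 1) ^ 2 * centred n L ^ 2 + 1 / (n + 1)) := by
    rw [hx]; simp only [centred]; field_simp; ring
  -- The second moment of the centred increment is `8 / 9` minus a term that is small on average.
  set p0 := (L / (n + 1) : ℝ)
  set p1 := (1 / (n + 1) : ℝ)
  set p2 := ((n - L) / (n + 1) : ℝ)
  set y := centred n L
  have hT : ∀ d : ℝ, |d| ≤ 2 → ‖Complex.exp ((θ * d : ℝ) * Complex.I) -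
      (1 + (θ * d : ℝ) * Complex.I - (θ * d : ℝ) ^ 2 / 2)‖ ≤ 2 * |θ| ^ 3 := fun d hd => by
    have h1 : |θ * d| ≤ 2 * |θ| := by
      rw [abs_mul]; nlinarith [abs_nonneg θ]
    refine (norm_exp_mul_I_sub_le (by linarith)).trans ?_
    have := pow_le_pow_left₀ (abs_nonneg _) h1 3
    nlinarith [this]
  have h0 := hT (0 - x) (by rw [abs_le]; constructor <;> linarith)
  have h1 := hT (1 - x) (by rw [abs_le]; constructor <;> linarith)
  have h2 := hT (2 - x) (by rw [abs_le]; constructor <;> linarith)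
  set e0 := Complex.exp ((θ * (0 - x) : ℝ) * Complex.I)
  set e1 := Complex.exp ((θ * (1 - x) : ℝ) * Complex.I)
  set e2 := Complex.exp ((θ * (2 - x) : ℝ) * Complex.I)
  have hexp : |Real.exp (-(4 / 9 * θ ^ 2)) - 1 - -(4 / 9 * θ ^ 2)| ≤ |θ| ^ 3 := by
    have ht : θ ^ 2 = |θ| ^ 2 := (sq_abs θ).symm
    have h0 := abs_nonneg θ
    have : θ ^ 2 ≤ 1 / 4 := by rw [ht]; nlinarith
    refine (Real.abs_exp_sub_one_sub_id_le ?_).trans ?_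
    · rw [abs_neg, abs_of_nonneg (by positivity)]; linarith
    · rw [ht]
      have : 0 ≤ |θ| ^ 3 := by positivity
      nlinarith
  set w := 4 / (3 * ((n : ℝ) + 1)) * y + 4 / ((n : ℝ) + 1) ^ 2 * y ^ 2 + 1 / ((n : ℝ) + 1)
  have hsumC : (p0 : ℂ) + p1 + p2 = 1 := mod_cast hsum
  have hmeanC : (p0 : ℂ) * (0 - x) + p1 * (1 - x) + p2 * (2 - x) = 0 := mod_cast hmean
  have hvarC : (p0 : ℂ) * (0 - x) ^ 2 + p1 * (1 - x) ^ 2 + p2 * (2 - x) ^ 2 = 8 / 9 - w := by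
    simpa using congrArg ((↑) : ℝ → ℂ) hvar
  have key : (p0 : ℂ) * e0 + p1 * e1 + p2 * e2 - (Real.exp (-(4 / 9 * θ ^ 2)) : ℝ) =
      p0 * (e0 - (1 + (θ * (0 - x) : ℝ) * Complex.I - (θ * (0 - x) : ℝ) ^ 2 / 2)) +
      p1 * (e1 - (1 + (θ * (1 - x) : ℝ) * Complex.I - (θ * (1 - x) : ℝ) ^ 2 / 2)) +
      p2 * (e2 - (1 + (θ * (2 - x) : ℝ) * Complex.I - (θ * (2 - x) : ℝ) ^ 2 / 2)) +
      (θ ^ 2 / 2 * w : ℝ) -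
      (Real.exp (-(4 / 9 * θ ^ 2)) - 1 - -(4 / 9 * θ ^ 2) : ℝ) := by
    push_cast
    linear_combination hsumC + θ * Complex.I * hmeanC - θ ^ 2 / 2 * hvarC
  rw [key]
  have hw : |w| ≤ 4 / (3 * (n + 1)) * |y| + 4 / (n + 1) ^ 2 * y ^ 2 + 1 / (n + 1) := by
    refine (abs_add_three _ _ _).trans (le_of_eq ?_)
    rw [abs_mul, abs_of_nonneg (by positivity : (0 : ℝ) ≤ 4 / (3 * (n + 1))),
      abs_of_nonneg (by positivity : (0 : ℝ) ≤ 4 / (n + 1) ^ 2 * y ^ 2),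
      abs_of_nonneg (by positivity : (0 : ℝ) ≤ 1 / (n + 1))]
  have hm : ∀ (p : ℝ) (z : ℂ), 0 ≤ p → ‖z‖ ≤ 2 * |θ| ^ 3 → ‖(p : ℂ) * z‖ ≤ p * (2 * |θ| ^ 3) :=
    fun p z hp hz => by
      rw [norm_mul, Complex.norm_real, Real.norm_of_nonneg hp]
      exact mul_le_mul_of_nonneg_left hz hp
  have hwn : ‖((θ ^ 2 / 2 * w : ℝ) : ℂ)‖ ≤ θ ^ 2 * (4 / (3 * (n + 1)) * |y| +
      4 / (n + 1) ^ 2 * y ^ 2 + 1 / (n + 1)) := by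
    rw [Complex.norm_real, Real.norm_eq_abs, abs_mul, abs_of_nonneg (by positivity)]
    refine mul_le_mul (by nlinarith [sq_nonneg θ]) hw (abs_nonneg _) (sq_nonneg _)
  refine (norm_sub_le _ _).trans ?_
  refine (add_le_add (norm_add_le _ _) le_rfl).trans ?_
  refine (add_le_add (add_le_add (norm_add₃_le) le_rfl) le_rfl).trans ?_
  have := hm p0 _ hp0 h0
  have := hm p1 _ hp1 h1
  have := hm p2 _ hp2 h2
  have : p0 * (2 * |θ| ^ 3) + p1 * (2 * |θ| ^ 3) + p2 * (2 * |θ| ^ 3) = 2 * |θ| ^ 3 := by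
    rw [← add_mul, ← add_mul, hsum, one_mul]
  rw [Complex.norm_real (Real.exp _ - 1 - _), Real.norm_eq_abs]
  linarith

/-- The characteristic function at `s` of `k (k - 1) (las - (4 k + 1) / 6)`, which is a martingale
along the chain. -/
noncomputable def martingaleCharFun (s : ℝ) (k : ℕ) : ℂ :=
  uniformMean k fun σ => Complex.exp ((s * (k * (k - 1)) * centred k (las σ) : ℝ) * Complex.I)

theorem norm_martingaleCharFun_succ_sub_le (s : ℝ) (k : ℕ) (hs : |s * (k * (k + 1))| ≤ 1 / 2) :
    ‖martingaleCharFun s (k + 1) -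
      (Real.exp (-(4 / 9 * (s * (k * (k + 1))) ^ 2)) : ℝ) * martingaleCharFun s k‖ ≤
      3 * |s * (k * (k + 1))| ^ 3 + (s * (k * (k + 1))) ^ 2 * (7 / √(k + 1)) := by
  rw [martingaleCharFun, martingaleCharFun, uniformMean_las_succ k (fun L => Complex.exp
    ((s * ((k + 1 : ℕ) * ((k + 1 : ℕ) - 1)) * centred (k + 1) L : ℝ) * Complex.I)),
    ← uniformMean_complex_const_mul, ← uniformMean_sub]
  refine (norm_uniformMean_le _).trans ?_
  set θ := s * (k * (k + 1)) with hθ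
  have hk : (k : ℝ) + 1 ≠ 0 := by positivity
  have hpt : ∀ τ : Equiv.Perm (Fin k), _ ≤ 3 * |θ| ^ 3 + θ ^ 2 * (4 / (3 * (k + 1)) *
      |centred k (las τ)| + 4 / (k + 1) ^ 2 * centred k (las τ) ^ 2 + 1 / (k + 1)) :=
    fun τ => norm_charFun_step_le (las_le τ) hs rfl
  have hmean : uniformMean k (fun τ => 3 * |θ| ^ 3 + θ ^ 2 * (4 / (3 * (k + 1)) *
      |centred k (las τ)| + 4 / (k + 1) ^ 2 * centred k (las τ) ^ 2 + 1 / (k + 1))) ≤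
      3 * |θ| ^ 3 + θ ^ 2 * (7 / √(k + 1)) := by
    rw [uniformMean_add, uniformMean_const, uniformMean_const_mul, uniformMean_add,
      uniformMean_add, uniformMean_const_mul, uniformMean_const_mul, uniformMean_const]
    refine add_le_add le_rfl (mul_le_mul_of_nonneg_left ?_ (sq_nonneg _))
    have h1 := uniformMean_abs_centred_le k
    have h2 := uniformMean_sq_centred_le k
    have hr : 1 ≤ √((k : ℝ) + 1) := Real.one_le_sqrt.2 (by simp)
    have hr2 : ((k : ℝ) + 1) = √((k : ℝ) + 1) ^ 2 := (Real.sq_sqrt (by positivity)).symm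
    set r := √((k : ℝ) + 1)
    rw [hr2] at h2 ⊢
    have hr0 : 0 < r := by linarith
    have h3 := mul_le_mul_of_nonneg_left h1 (by positivity : 0 ≤ 4 / (3 * r ^ 2))
    have h4 := mul_le_mul_of_nonneg_left h2 (by positivity : 0 ≤ 4 / (r ^ 2) ^ 2)
    have e3 : 4 / (3 * r ^ 2) * r = 4 / 3 * (1 / r) := by field_simp
    have e4 : 4 / (r ^ 2) ^ 2 * r ^ 2 = 4 * (1 / r ^ 2) := by field_simp
    have e5 : 1 / r ^ 2 ≤ 1 / r := one_div_le_one_div_of_le hr0 (by nlinarith)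
    have e6 : 7 / r = 7 * (1 / r) := by ring
    have e7 : 0 < 1 / r := by positivity
    rw [e6]
    linarith
  refine le_trans (uniformMean_mono fun τ => ?_) hmean
  refine le_trans (le_of_eq ?_) (hpt τ)
  set z := Complex.exp ((s * (k * (k - 1)) * centred k (las τ) : ℝ) * Complex.I) with hz
  have hzn : ‖z‖ = 1 := Complex.norm_exp_ofReal_mul_I _
  have he : ∀ j : ℕ, Complex.exp ((s * ((k + 1 : ℕ) * ((k + 1 : ℕ) - 1)) *
      centred (k + 1) (las τ + j) : ℝ) * Complex.I) =
      z * Complex.exp ((θ * (j - (2 * k + 1 - 2 * las τ) / (k + 1)) : ℝ) * Complex.I) := fun j => by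
    rw [hz, ← Complex.exp_add, ← add_mul, ← Complex.ofReal_add]
    congr 4
    rw [hθ]
    simp only [centred]
    push_cast
    field_simp
    ring
  have he0 := he 0
  have he1 := he 1
  have he2 := he 2
  rw [add_zero] at he0
  rw [he0, he1, he2]
  have hm : ∀ w : ℂ, ‖z * w‖ = ‖w‖ := fun w => by rw [norm_mul, hzn, one_mul]
  refine Eq.trans ?_ (hm _)
  congr 1
  simp only [Complex.real_smul]
  push_cast
  ring

/-- The errors of the single steps add up, as the Gaussian factors have modulus at most one. -/
theorem norm_martingaleCharFun_sub_exp_le (s B : ℝ) (hB : B ≤ 1 / 2) (N : ℕ)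
    (h : ∀ k < N, |s * (k * (k + 1))| ≤ B) :
    ‖martingaleCharFun s N -
      (Real.exp (-(4 / 9 * ∑ k ∈ Finset.range N, (s * (k * (k + 1))) ^ 2)) : ℝ)‖ ≤
      ∑ k ∈ Finset.range N, (3 * B ^ 3 + B ^ 2 * (7 / √(k + 1))) := by
  induction N with
  | zero => simp [martingaleCharFun, uniformMean_const]
  | succ N ih =>
    have ih := ih fun k hk => h k (by omega)
    have hN := h N (by omega)
    have h1 := norm_martingaleCharFun_succ_sub_le s N (hN.trans hB)
    rw [Finset.sum_range_succ, Finset.sum_range_succ]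
    set θ := s * (N * (N + 1)) with hθ
    set S := ∑ k ∈ Finset.range N, (s * (k * (k + 1))) ^ 2
    set x := Real.exp (-(4 / 9 * θ ^ 2)) with hx
    have hx1 : x ≤ 1 := Real.exp_le_one_iff.2 (by have := sq_nonneg θ; linarith)
    have hx0 : 0 ≤ x := (Real.exp_pos _).le
    have hS : Real.exp (-(4 / 9 * (S + θ ^ 2))) = x * Real.exp (-(4 / 9 * S)) := by
      rw [hx, ← Real.exp_add]; congr 1; ring
    have h2 : 3 * |θ| ^ 3 + θ ^ 2 * (7 / √(N + 1)) ≤ 3 * B ^ 3 + B ^ 2 * (7 / √(N + 1)) := by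
      rw [← sq_abs θ]
      gcongr
    rw [hS]
    have e : martingaleCharFun s (N + 1) - ((x * Real.exp (-(4 / 9 * S)) : ℝ) : ℂ) =
        x * (martingaleCharFun s N - (Real.exp (-(4 / 9 * S)) : ℝ)) +
        (martingaleCharFun s (N + 1) - x * martingaleCharFun s N) := by
      push_cast; ring
    rw [e]
    refine (norm_add_le _ _).trans (add_le_add ?_ (h1.trans h2))
    rw [norm_mul, Complex.norm_real, Real.norm_of_nonneg hx0]
    exact (mul_le_of_le_one_left (norm_nonneg _) hx1).trans ih

/-- This sum over `k < N` is asymptotic to `N ^ 5 / 5`; multiplied by `8 / 9` it yields the variance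
`8 / 45`. -/
theorem sum_sq_mul_succ (N : ℕ) :
    ∑ k ∈ Finset.range N, ((k : ℝ) * (k + 1)) ^ 2 =
      (N : ℝ) * (N ^ 2 - 1) * (3 * N ^ 2 - 2) / 15 := by
  induction N with
  | zero => simp
  | succ N ih => rw [Finset.sum_range_succ, ih]; push_cast; ring

theorem tendsto_inv_sqrt_nat : Tendsto (fun n : ℕ => (√(n : ℝ))⁻¹) atTop (𝓝 0) :=
  tendsto_inv_atTop_zero.comp (Real.tendsto_sqrt_atTop.comp tendsto_natCast_atTop_atTop)

/-- At the frequencies `t / N ^ (5 / 2)`, at which the increments of the martingale are of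
order `N ^ (-1 / 2)`, the characteristic functions converge to the Gaussian one. -/
theorem tendsto_martingaleCharFun (t : ℝ) :
    Tendsto (fun N : ℕ => martingaleCharFun (t / (N ^ 2 * √N)) N) atTop
      (𝓝 (Real.exp (-(4 / 45 * t ^ 2)) : ℝ)) := by
  have hsum : Tendsto (fun N : ℕ => ∑ k ∈ Finset.range N,
      (t / ((N : ℝ) ^ 2 * √N) * (k * (k + 1))) ^ 2) atTop (𝓝 (t ^ 2 * 5⁻¹)) := by
    have hN : Tendsto (fun N : ℕ => ((N : ℝ))⁻¹ ^ 2) atTop (𝓝 0) := by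
      simpa using (tendsto_inv_atTop_nhds_zero_nat (𝕜 := ℝ)).pow 2
    have h1 : Tendsto
        (fun N : ℕ => t ^ 2 * ((1 - ((N : ℝ))⁻¹ ^ 2) * (3 - 2 * ((N : ℝ))⁻¹ ^ 2) / 15))
        atTop (𝓝 (t ^ 2 * ((1 - 0) * (3 - 2 * 0) / 15))) :=
      (((hN.const_sub 1).mul ((hN.const_mul 2).const_sub 3)).div_const 15).const_mul _
    rw [show (1 - 0) * (3 - 2 * 0) / 15 = (5 : ℝ)⁻¹ by norm_num] at h1
    refine h1.congr' ?_
    filter_upwards [eventually_ge_atTop 1] with N hN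
    have hN0 : (N : ℝ) ≠ 0 := by positivity
    have hr : √(N : ℝ) ^ 2 = N := Real.sq_sqrt (by positivity)
    simp only [mul_pow (_ / _), ← Finset.mul_sum]
    rw [sum_sq_mul_succ, div_pow, mul_pow, hr]
    field_simp
  have hmain : Tendsto (fun N : ℕ => martingaleCharFun (t / (N ^ 2 * √N)) N -
      (Real.exp (-(4 / 9 * ∑ k ∈ Finset.range N,
        (t / ((N : ℝ) ^ 2 * √N) * (k * (k + 1))) ^ 2)) : ℝ)) atTop (𝓝 0) := by
    have hB : Tendsto (fun N : ℕ => |t| * (√(N : ℝ))⁻¹) atTop (𝓝 0) := by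
      simpa using tendsto_inv_sqrt_nat.const_mul |t|
    have hces : Tendsto (fun N : ℕ => (N : ℝ)⁻¹ * ∑ k ∈ Finset.range N, (√((k : ℝ) + 1))⁻¹) atTop
        (𝓝 0) := by
      have := (tendsto_inv_sqrt_nat.comp (tendsto_add_atTop_nat 1)).cesaro
      simpa [Function.comp_def] using this
    have hbound : Tendsto (fun N : ℕ => 3 * |t| ^ 3 * (√(N : ℝ))⁻¹ + 7 * t ^ 2 *
        ((N : ℝ)⁻¹ * ∑ k ∈ Finset.range N, (√((k : ℝ) + 1))⁻¹)) atTop (𝓝 0) := by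
      simpa using (tendsto_inv_sqrt_nat.const_mul (3 * |t| ^ 3)).add (hces.const_mul (7 * t ^ 2))
    refine squeeze_zero_norm' ?_ hbound
    filter_upwards [eventually_ge_atTop 1, hB.eventually_le_const (by norm_num : (0 : ℝ) < 1 / 2)]
      with N hN hN2
    have hN0 : (0 : ℝ) < N := by positivity
    have hr0 : 0 < √(N : ℝ) := by positivity
    have hr : √(N : ℝ) ^ 2 = N := Real.sq_sqrt (by positivity)
    refine (norm_martingaleCharFun_sub_exp_le _ _ hN2 N fun k hk => ?_).trans (le_of_eq ?_)
    · have hk' : (k : ℝ) + 1 ≤ N := mod_cast hk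
      have hk0 : (0 : ℝ) ≤ k := by positivity
      have e : |t / ((N : ℝ) ^ 2 * √N) * (k * (k + 1))| =
          |t| * (√(N : ℝ))⁻¹ * ((k * (k + 1)) / (N : ℝ) ^ 2) := by
        rw [abs_mul, abs_div, abs_of_pos (by positivity : (0 : ℝ) < (N : ℝ) ^ 2 * √N),
          abs_of_nonneg (by positivity : (0 : ℝ) ≤ k * (k + 1))]
        field_simp
      rw [e]
      refine mul_le_of_le_one_right (by positivity) ?_
      rw [div_le_one (by positivity)]
      nlinarith
    · have e2 : ((√(N : ℝ))⁻¹) ^ 2 = (N : ℝ)⁻¹ := by rw [inv_pow, hr]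
      have e3 : (N : ℝ) * ((√(N : ℝ))⁻¹) ^ 3 = (√(N : ℝ))⁻¹ := by
        rw [pow_succ, e2]; field_simp
      simp only [Finset.sum_add_distrib, ← Finset.mul_sum, Finset.sum_const, Finset.card_range,
        nsmul_eq_mul, div_eq_mul_inv]
      rw [mul_pow, mul_pow, e2, sq_abs, show 3 * ((N : ℝ) * (|t| ^ 3 * (√(N : ℝ))⁻¹ ^ 3)) =
        3 * |t| ^ 3 * (N * (√(N : ℝ))⁻¹ ^ 3) by ring, e3]
      ring
  have hlim := hmain.add ((Complex.continuous_ofReal.tendsto _).comp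
    ((Real.continuous_exp.tendsto _).comp (hsum.const_mul (4 / 9)).neg))
  simp only [Function.comp_def, sub_add_cancel, zero_add] at hlim
  convert hlim using 4
  ring

theorem norm_exp_ofReal_mul_I_sub_le (a b : ℝ) :
    ‖Complex.exp (a * Complex.I) - Complex.exp (b * Complex.I)‖ ≤ |a - b| := by
  have h : Complex.exp (a * Complex.I) - Complex.exp (b * Complex.I) =
      Complex.exp (b * Complex.I) * (Complex.exp (Complex.I * ((a - b : ℝ) : ℂ)) - 1) := by
    rw [mul_sub, ← Complex.exp_add]
    push_cast
    ring_nf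
  rw [h, norm_mul, Complex.norm_exp_ofReal_mul_I, one_mul]
  exact Real.norm_exp_I_mul_ofReal_sub_one_le

theorem tendsto_sqrt_succ_div : Tendsto (fun n : ℕ => √((n : ℝ) + 1) / n) atTop (𝓝 0) := by
  have h : Tendsto (fun n : ℕ => √2 * (√(n : ℝ))⁻¹) atTop (𝓝 0) := by
    simpa using tendsto_inv_sqrt_nat.const_mul √2
  refine squeeze_zero' (Eventually.of_forall fun n => by positivity) ?_ h
  filter_upwards [eventually_ge_atTop 1] with n hn
  have hn1 : (1 : ℝ) ≤ n := mod_cast hn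
  have hr : √(n : ℝ) * √n = n := Real.mul_self_sqrt (by positivity)
  have hr0 : 0 < √(n : ℝ) := by positivity
  have h2 : √((n : ℝ) + 1) ≤ √2 * √n := by
    rw [← Real.sqrt_mul (by norm_num)]
    exact Real.sqrt_le_sqrt (by linarith)
  rw [div_le_iff₀ (by positivity)]
  refine h2.trans (le_of_eq ?_)
  nth_rw 3 [← hr]
  field_simp

/-- The characteristic functions of the normalised longest alternating subsequence of a uniform
permutation converge to that of the normal law of variance `8 / 45`. -/
theorem tendsto_uniformMean_exp (t : ℝ) :
    Tendsto (fun n : ℕ => uniformMean n fun σ =>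
      Complex.exp ((t * ((las σ - 2 / 3 * n) / √n) : ℝ) * Complex.I)) atTop
      (𝓝 (Real.exp (-(4 / 45 * t ^ 2)) : ℝ)) := by
  have hdiff : Tendsto (fun n : ℕ => (uniformMean n fun σ =>
      Complex.exp ((t * ((las σ - 2 / 3 * n) / √n) : ℝ) * Complex.I)) -
      martingaleCharFun (t / (n ^ 2 * √n)) n) atTop (𝓝 0) := by
    have hb : Tendsto (fun n : ℕ => |t| * ((6⁻¹ + √((n : ℝ) + 1) / n) * (√(n : ℝ))⁻¹)) atTop
        (𝓝 0) := by
      simpa using ((tendsto_sqrt_succ_div.const_add 6⁻¹).mul tendsto_inv_sqrt_nat).const_mul |t|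
    refine squeeze_zero_norm' ?_ hb
    filter_upwards [eventually_ge_atTop 1] with n hn
    have hn0 : (0 : ℝ) < n := by positivity
    have hr0 : 0 < √(n : ℝ) := by positivity
    rw [martingaleCharFun, ← uniformMean_sub]
    refine (norm_uniformMean_le _).trans ?_
    have hpt : ∀ σ : Equiv.Perm (Fin n), _ ≤ |t| * (√(n : ℝ))⁻¹ *
        (6⁻¹ + (n : ℝ)⁻¹ * |centred n (las σ)|) := fun σ => by
      refine (norm_exp_ofReal_mul_I_sub_le (t * ((las σ - 2 / 3 * n) / √n))
        (t / (n ^ 2 * √n) * (n * (n - 1)) * centred n (las σ))).trans ?_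
      have e : t * ((las σ - 2 / 3 * n) / √n) - t / (n ^ 2 * √n) * (n * (n - 1)) *
          centred n (las σ) = t * (√(n : ℝ))⁻¹ * (6⁻¹ + (n : ℝ)⁻¹ * centred n (las σ)) := by
        simp only [centred]
        field_simp
        ring
      rw [e, abs_mul, abs_mul, abs_of_pos (inv_pos.2 hr0)]
      gcongr
      refine (abs_add_le _ _).trans ?_
      rw [abs_mul, abs_of_pos (inv_pos.2 hn0), abs_of_pos (by norm_num : (0 : ℝ) < 6⁻¹)]
    refine (uniformMean_mono hpt).trans ?_
    rw [uniformMean_const_mul, uniformMean_add, uniformMean_const, uniformMean_const_mul,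
      mul_assoc, mul_comm (√(n : ℝ))⁻¹, div_eq_inv_mul (√((n : ℝ) + 1))]
    have := uniformMean_abs_centred_le n
    gcongr
  simpa using hdiff.add (tendsto_martingaleCharFun t)

/-- The law of large numbers for uniform permutations, in mean. -/
theorem tendsto_uniformMean_abs :
    Tendsto (fun n : ℕ => uniformMean n fun σ => |(las σ : ℝ) / n - 2 / 3|) atTop (𝓝 0) := by
  have hb : Tendsto (fun n : ℕ => √((n : ℝ) + 1) / n + 6⁻¹ * (n : ℝ)⁻¹) atTop (𝓝 0) := by
    simpa using tendsto_sqrt_succ_div.add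
      ((tendsto_inv_atTop_nhds_zero_nat (𝕜 := ℝ)).const_mul 6⁻¹)
  refine squeeze_zero_norm' ?_ hb
  filter_upwards [eventually_ge_atTop 1] with n hn
  have hn0 : (0 : ℝ) < n := by positivity
  refine (norm_uniformMean_le _).trans ?_
  have hpt : ∀ σ : Equiv.Perm (Fin n), ‖|(las σ : ℝ) / n - 2 / 3|‖ ≤
      (n : ℝ)⁻¹ * |centred n (las σ)| + 6⁻¹ * (n : ℝ)⁻¹ := fun σ => by
    have e : (las σ : ℝ) / n - 2 / 3 = (n : ℝ)⁻¹ * centred n (las σ) + 6⁻¹ * (n : ℝ)⁻¹ := by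
      simp only [centred]; field_simp; ring
    rw [Real.norm_eq_abs, abs_abs, e]
    refine (abs_add_le _ _).trans ?_
    rw [abs_mul, abs_of_pos (inv_pos.2 hn0), abs_of_pos (by positivity : 0 < 6⁻¹ * (n : ℝ)⁻¹)]
  refine (uniformMean_mono hpt).trans ?_
  rw [uniformMean_add, uniformMean_const_mul, uniformMean_const, div_eq_inv_mul (√((n : ℝ) + 1))]
  have := uniformMean_abs_centred_le n
  gcongr

/-! ### Conjugation invariant permutations -/

instance discreteMeasurableSpace_perm (n : ℕ) : DiscreteMeasurableSpace (Equiv.Perm (Fin n)) :=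
  ⟨fun _ => trivial⟩

theorem integrable_comp_perm {E : Type*} [NormedAddCommGroup E] {n : ℕ} {Ω : Type*}
    [MeasurableSpace Ω] {P : Measure Ω} [IsProbabilityMeasure P] {σ : Ω → Equiv.Perm (Fin n)}
    (hσ : Measurable σ) (g : Equiv.Perm (Fin n) → E) : Integrable (fun ω => g (σ ω)) P := by
  have : Integrable g (P.map σ) := .of_finite
  exact this.comp_measurable hσ

section
variable {E : Type*} [NormedAddCommGroup E] [NormedSpace ℝ E] {n : ℕ}

theorem uniformMean_conj (g : Equiv.Perm (Fin n) → E) (τ : Equiv.Perm (Fin n)) :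
    uniformMean n (fun σ => g (τ * σ * τ⁻¹)) = uniformMean n g := by
  rw [uniformMean, uniformMean, ← (MulAut.conj τ).toEquiv.sum_comp g]
  rfl

theorem uniformMean_comm (F : Equiv.Perm (Fin n) → Equiv.Perm (Fin n) → E) :
    uniformMean n (fun σ => uniformMean n fun τ => F σ τ) =
      uniformMean n fun τ => uniformMean n fun σ => F σ τ := by
  simp only [uniformMean, ← Finset.smul_sum]
  rw [Finset.sum_comm]

/-- Averages over conjugacy classes hardly depend on the class as long as there are few cycles:
all classes are compared with the class of the cyclic permutations. -/
theorem exists_norm_uniformMean_conj_sub_le (hn : 1 ≤ n) (g : Equiv.Perm (Fin n) → E) {K D : ℝ}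
    (hK : 0 ≤ K) (hg : ∀ σ ρ, ‖g σ - g ρ‖ ≤ K * hammingDist σ ρ) (hD : ∀ σ, ‖g σ‖ ≤ D) :
    ∃ m : E, ∀ σ : Equiv.Perm (Fin n), ‖uniformMean n (fun τ => g (τ * σ * τ⁻¹)) - m‖ ≤
      min (2 * K * numCycles σ) (2 * D) := by
  obtain ⟨c₀, hc₀, -⟩ := exists_numCycles_eq_one hn (1 : Equiv.Perm (Fin n))
  refine ⟨uniformMean n fun τ => g (τ * c₀ * τ⁻¹), fun σ => ?_⟩
  obtain ⟨c, hc, hd⟩ := exists_numCycles_eq_one hn σ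
  obtain ⟨ρ, hρ⟩ := isConj_iff.1 (isConj_of_numCycles_eq_one hc₀ hc)
  have hm : uniformMean n (fun τ => g (τ * c₀ * τ⁻¹)) = uniformMean n fun τ => g (τ * c * τ⁻¹) := by
    rw [uniformMean, uniformMean, ← Equiv.sum_comp (Equiv.mulRight ρ) (fun τ => g (τ * c₀ * τ⁻¹))]
    simp [← hρ, mul_assoc]
  rw [hm, ← uniformMean_sub]
  refine (norm_uniformMean_le _).trans ((uniformMean_mono fun τ => ?_).trans_eq
    (uniformMean_const (n := n) (min (2 * K * (numCycles σ : ℝ)) (2 * D))))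
  refine le_min ?_ ?_
  · refine (hg _ _).trans ?_
    rw [hammingDist_conj]
    have : (hammingDist σ c : ℝ) ≤ 2 * numCycles σ := mod_cast hd
    nlinarith
  · refine (norm_sub_le _ _).trans ?_
    linarith [hD (τ * σ * τ⁻¹), hD (τ * c * τ⁻¹)]

variable {Ω : Type*} [MeasurableSpace Ω] {P : Measure Ω} [IsProbabilityMeasure P]
  {σ : Ω → Equiv.Perm (Fin n)}

/-- The law of a conjugation invariant permutation is a mixture of the uniform laws on conjugacy
classes, and so is the uniform law; both are compared with the uniform law on the cyclic
permutations. -/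
theorem norm_integral_sub_uniformMean_le [CompleteSpace E] (hn : 1 ≤ n) (hσ : Measurable σ)
    (hinv : ∀ τ : Equiv.Perm (Fin n), IdentDistrib σ (fun ω => τ⁻¹ * σ ω * τ) P P)
    (g : Equiv.Perm (Fin n) → E) {K D : ℝ}
    (hK : 0 ≤ K) (hg : ∀ σ ρ, ‖g σ - g ρ‖ ≤ K * hammingDist σ ρ) (hD : ∀ σ, ‖g σ‖ ≤ D) :
    ‖∫ ω, g (σ ω) ∂P - uniformMean n g‖ ≤
      ∫ ω, min (2 * K * numCycles (σ ω)) (2 * D) ∂P + 2 * K * harmonic n := by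
  obtain ⟨m, hm⟩ := exists_norm_uniformMean_conj_sub_le hn g hK hg hD
  have h1 : ‖∫ ω, g (σ ω) ∂P - m‖ ≤ ∫ ω, min (2 * K * numCycles (σ ω)) (2 * D) ∂P := by
    have hconj : ∀ τ : Equiv.Perm (Fin n), ∫ ω, g (τ * σ ω * τ⁻¹) ∂P = ∫ ω, g (σ ω) ∂P :=
      fun τ => by
        let _ : MeasurableSpace E := borel E
        have : BorelSpace E := ⟨rfl⟩
        have := ((hinv τ⁻¹).comp (u := g) .of_discrete).integral_eq
        simpa [Function.comp_def] using this.symm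
    have hmean : ∫ ω, g (σ ω) ∂P = ∫ ω, uniformMean n (fun τ => g (τ * σ ω * τ⁻¹)) ∂P := by
      simp only [uniformMean]
      rw [integral_smul, integral_finsetSum _ fun τ _ =>
        integrable_comp_perm hσ fun ρ => g (τ * ρ * τ⁻¹)]
      simp only [hconj]
      exact (uniformMean_const _).symm
    rw [hmean]
    calc _ = ‖∫ ω, (uniformMean n (fun τ => g (τ * σ ω * τ⁻¹)) - m) ∂P‖ := by
          rw [integral_sub (integrable_comp_perm hσ fun ρ => uniformMean n fun τ => g (τ * ρ * τ⁻¹))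
            (integrable_const _)]
          simp
      _ ≤ _ := norm_integral_le_of_norm_le
          (integrable_comp_perm hσ fun ρ => min (2 * K * (numCycles ρ : ℝ)) (2 * D))
          (Eventually.of_forall fun ω => hm (σ ω))
  have h2 : ‖uniformMean n g - m‖ ≤ 2 * K * harmonic n := by
    have hmean : uniformMean n g = uniformMean n fun σ => uniformMean n fun τ =>
        g (τ * σ * τ⁻¹) := by
      rw [uniformMean_comm]
      simp only [uniformMean_conj, uniformMean_const]
    rw [hmean, ← uniformMean_const (n := n) m, ← uniformMean_sub, ← uniformMean_numCycles,
      ← uniformMean_const_mul]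
    exact (norm_uniformMean_le _).trans (uniformMean_mono fun σ => (hm σ).trans (min_le_left _ _))
  calc _ = ‖(∫ ω, g (σ ω) ∂P - m) - (uniformMean n g - m)‖ := by congr 1; abel
    _ ≤ _ := (norm_sub_le _ _).trans (add_le_add h1 h2)

end

section
variable {Ω : ℕ → Type*} [∀ n, MeasurableSpace (Ω n)] {P : ∀ n, Measure (Ω n)}
  [∀ n, IsProbabilityMeasure (P n)]

theorem TendstoInProb.tendsto_integral_min {X : ∀ n, Ω n → ℝ} (hX : ∀ n, Measurable (X n))
    (hX0 : ∀ n ω, 0 ≤ X n ω) (h : TendstoInProb P X 0) {A D : ℝ} (hA : 0 ≤ A) (hD : 0 ≤ D) :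
    Tendsto (fun n => ∫ ω, min (A * X n ω) D ∂(P n)) atTop (𝓝 0) := by
  have hint : ∀ n, Integrable (fun ω => min (A * X n ω) D) (P n) := fun n =>
    Integrable.of_bound (((hX n).const_mul A).min measurable_const).aestronglyMeasurable D
      (Eventually.of_forall fun ω => by
        rw [Real.norm_of_nonneg (le_min (mul_nonneg hA (hX0 n ω)) hD)]
        exact min_le_right _ _)
  rw [Metric.tendsto_atTop]
  intro ε hε
  -- Below the level `δ` the integrand is at most `A δ < ε / 2`; above it, it is at most `D`.
  set δ := ε / (2 * (A + 1)) with hδ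
  have hδ0 : 0 < δ := by positivity
  have hAδ : A * δ < ε / 2 := by
    have : (A + 1) * δ = ε / 2 := by rw [hδ]; field_simp
    nlinarith
  have hprob : Tendsto (fun n => D * (P n).real {ω | δ ≤ |X n ω - 0|}) atTop (𝓝 0) := by
    simpa [Measure.real] using
      ((ENNReal.tendsto_toReal ENNReal.zero_ne_top).comp (h δ hδ0)).const_mul D
  obtain ⟨N, hN⟩ := eventually_atTop.1 (hprob.eventually_lt_const (by positivity : 0 < ε / 2))
  refine ⟨N, fun n hn => ?_⟩
  have hms : MeasurableSet {ω | δ ≤ |X n ω - 0|} :=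
    measurableSet_le measurable_const (by fun_prop)
  have hle : ∫ ω, min (A * X n ω) D ∂(P n) ≤
      ∫ ω, (A * δ + {ω | δ ≤ |X n ω - 0|}.indicator (fun _ => D) ω) ∂(P n) := by
    refine integral_mono (hint n) ((integrable_const _).add ((integrable_const _).indicator hms))
      fun ω => ?_
    by_cases hω : δ ≤ |X n ω - 0|
    · simp only [Set.indicator, Set.mem_ofPred_eq, hω, if_true]
      exact (min_le_right _ _).trans (by have := mul_nonneg hA hδ0.le; linarith)
    · simp only [Set.indicator, Set.mem_ofPred_eq, hω, if_false, add_zero]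
      rw [sub_zero, abs_of_nonneg (hX0 n ω), not_le] at hω
      exact (min_le_left _ _).trans (mul_le_mul_of_nonneg_left hω.le hA)
  rw [integral_add (integrable_const _) ((integrable_const _).indicator hms),
    integral_indicator_const _ hms] at hle
  have h0 : 0 ≤ ∫ ω, min (A * X n ω) D ∂(P n) :=
    integral_nonneg fun ω => le_min (mul_nonneg hA (hX0 n ω)) hD
  have := hN n hn
  rw [Real.dist_eq, sub_zero, abs_of_nonneg h0]
  simp at hle this
  linarith

/-- For Lipschitz test functions a conjugation invariant permutation with few cycles may be replaced
by a uniform one: if `g n` varies by at most `A / n ^ (1 / α)` when one value of the permutation is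
changed, the expectations of `g n` under the given laws and under the uniform laws approach
each other. -/
theorem HInv.tendsto_integral_sub_uniformMean {α : ℝ} (hα : 0 < α)
    {σ : ∀ n, Ω n → Equiv.Perm (Fin n)}
    (hσ : ∀ n, Measurable (σ n)) (h : HInv α P σ) {E : Type*} [NormedAddCommGroup E]
    [NormedSpace ℝ E] [CompleteSpace E] (g : ∀ n, Equiv.Perm (Fin n) → E) {A D : ℝ}
    (hA : 0 ≤ A) (hD : 0 ≤ D)
    (hg : ∀ n σ ρ, ‖g n σ - g n ρ‖ ≤ A / (n : ℝ) ^ (1 / α) * hammingDist σ ρ)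
    (hgD : ∀ n σ, ‖g n σ‖ ≤ D) :
    Tendsto (fun n => ∫ ω, g n (σ n ω) ∂(P n) - uniformMean n (g n)) atTop (𝓝 0) := by
  have h1 := h.2.tendsto_integral_min
    (X := fun n ω => (numCycles (σ n ω) : ℝ) / (n : ℝ) ^ (1 / α))
    (fun n => (measurable_of_finite fun ρ : Equiv.Perm (Fin n) =>
    (numCycles ρ : ℝ) / (n : ℝ) ^ (1 / α)).comp (hσ n)) (fun n ω => by positivity)
    (by positivity : 0 ≤ 2 * A) (by positivity : 0 ≤ 2 * D)
  have h2 : Tendsto (fun n : ℕ => 2 * (A / (n : ℝ) ^ (1 / α)) * harmonic n) atTop (𝓝 0) := by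
    have hlog : Tendsto (fun n : ℕ => 2 * A * ((n : ℝ) ^ (-(1 / α)) +
        Real.log n / (n : ℝ) ^ (1 / α))) atTop (𝓝 0) := by
      have ha : Tendsto (fun n : ℕ => (n : ℝ) ^ (-(1 / α))) atTop (𝓝 0) :=
        (tendsto_rpow_neg_atTop (by positivity)).comp tendsto_natCast_atTop_atTop
      have hb : Tendsto (fun n : ℕ => Real.log n / (n : ℝ) ^ (1 / α)) atTop (𝓝 0) :=
        (isLittleO_log_rpow_atTop (by positivity : 0 < 1 / α)).tendsto_div_nhds_zero.comp
          tendsto_natCast_atTop_atTop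
      simpa using (ha.add hb).const_mul (2 * A)
    refine squeeze_zero (fun n => ?_) (fun n => ?_) hlog
    · have : (0 : ℝ) ≤ harmonic n := by
        rw [harmonic]; push_cast; positivity
      positivity
    · have := harmonic_le_one_add_log n
      calc _ ≤ 2 * (A / (n : ℝ) ^ (1 / α)) * (1 + Real.log n) := by gcongr
        _ = _ := by rw [Real.rpow_neg (by positivity)]; ring
  refine squeeze_zero_norm' ?_ (by simpa only [add_zero] using h1.add h2)
  filter_upwards [eventually_ge_atTop 1] with n hn
  refine (norm_integral_sub_uniformMean_le hn (hσ n) (h.1 n) (g n) (by positivity) (hg n)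
    (hgD n)).trans (le_of_eq ?_)
  congr 2
  ext ω
  congr 1
  ring

/-! ### The limit theorems -/

theorem HInv.tendsto_integral_abs {σ : ∀ n, Ω n → Equiv.Perm (Fin n)}
    (hσ : ∀ n, Measurable (σ n)) (h : HInv 1 P σ) :
    Tendsto (fun n => ∫ ω, |(las (σ n ω) : ℝ) / n - 2 / 3| ∂(P n)) atTop (𝓝 0) := by
  have hmain := h.tendsto_integral_sub_uniformMean one_pos hσ
    (fun n σ => |(las σ : ℝ) / n - 2 / 3|) (A := 3) (D := 1) (by norm_num) (by norm_num)
    (fun n σ ρ => by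
      rw [Real.norm_eq_abs]
      refine (abs_abs_sub_abs_le_abs_sub _ _).trans ?_
      have e : (las σ : ℝ) / n - 2 / 3 - (las ρ / n - 2 / 3) = (las σ - las ρ) / n := by ring
      rw [e, abs_div, Nat.abs_cast, div_one, Real.rpow_one, div_mul_eq_mul_div]
      gcongr
      exact abs_las_sub_las_le σ ρ)
    (fun n σ => by
      have h0 : (0 : ℝ) ≤ (las σ : ℝ) / n := by positivity
      have h1 : (las σ : ℝ) / n ≤ 1 := div_le_one_of_le₀ (mod_cast las_le σ) (by positivity)
      rw [Real.norm_eq_abs, abs_abs, abs_le]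
      constructor <;> linarith)
  simpa using hmain.add tendsto_uniformMean_abs

theorem tendstoInProb_of_tendsto_integral_abs {X : ∀ n, Ω n → ℝ} {c : ℝ}
    (hint : ∀ n, Integrable (X n) (P n))
    (h : Tendsto (fun n => ∫ ω, |X n ω - c| ∂(P n)) atTop (𝓝 0)) : TendstoInProb P X c := by
  intro ε hε
  have hle : ∀ n, (P n).real {ω | ε ≤ |X n ω - c|} ≤ ε⁻¹ * ∫ ω, |X n ω - c| ∂(P n) := fun n => by
    have := mul_meas_ge_le_integral_of_nonneg (μ := P n) (f := fun ω => |X n ω - c|)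
      (Eventually.of_forall fun ω => abs_nonneg _) ((hint n).sub (integrable_const c)).abs ε
    rw [inv_mul_eq_div, le_div_iff₀ hε, mul_comm]
    exact this
  have hr : Tendsto (fun n => (P n).real {ω | ε ≤ |X n ω - c|}) atTop (𝓝 0) :=
    squeeze_zero (fun n => measureReal_nonneg) hle (by simpa using h.const_mul ε⁻¹)
  have := (ENNReal.tendsto_ofReal hr)
  simpa using this

end

theorem mainTheorem9 {Ω : ℕ → Type*} [∀ n, MeasurableSpace (Ω n)]
    (P : ∀ n, Measure (Ω n)) [∀ n, IsProbabilityMeasure (P n)]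
    (σ : ∀ n, Ω n → Equiv.Perm (Fin n)) (hσ : ∀ n, Measurable (σ n)) :
    (HInv 1 P σ →
      TendstoInProb P (fun n ω => (las (σ n ω) : ℝ) / n) (2 / 3) ∧
      (fun n : ℕ => (∫ ω, (las (σ n ω) : ℝ) ∂(P n)) - 2 / 3 * (n : ℝ))
        =o[atTop] (fun n : ℕ => (n : ℝ))) ∧
    (HInv 2 P σ →
      TendstoInDistribution
        (fun n ω => ((las (σ n ω) : ℝ) - 2 / 3 * (n : ℝ)) / √(n : ℝ))
        atTop (id : ℝ → ℝ) P (gaussianReal 0 (8 / 45))) := by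
  refine ⟨fun h => ⟨?_, ?_⟩, fun h => ?_⟩
  · exact tendstoInProb_of_tendsto_integral_abs
      (fun n => integrable_comp_perm (hσ n) fun ρ => (las ρ : ℝ) / n) (h.tendsto_integral_abs hσ)
  · rw [isLittleO_iff_tendsto' (by
      filter_upwards [eventually_ge_atTop 1] with n hn hn0
      simp at hn0; omega)]
    refine squeeze_zero_norm' ?_ (h.tendsto_integral_abs hσ)
    filter_upwards [eventually_ge_atTop 1] with n hn
    have hn0 : (n : ℝ) ≠ 0 := by positivity
    have e : ((∫ ω, (las (σ n ω) : ℝ) ∂(P n)) - 2 / 3 * (n : ℝ)) / n =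
        ∫ ω, ((las (σ n ω) : ℝ) / n - 2 / 3) ∂(P n) := by
      rw [integral_sub (integrable_comp_perm (hσ n) fun ρ => (las ρ : ℝ) / n) (integrable_const _),
        integral_div]
      simp
      field_simp
    rw [e]
    exact norm_integral_le_integral_norm _
  · have hmeas : ∀ n, Measurable fun ω => ((las (σ n ω) : ℝ) - 2 / 3 * (n : ℝ)) / √(n : ℝ) :=
      fun n => (measurable_of_finite fun ρ : Equiv.Perm (Fin n) =>
        ((las ρ : ℝ) - 2 / 3 * (n : ℝ)) / √(n : ℝ)).comp (hσ n)
    refine ⟨fun n => (hmeas n).aemeasurable, aemeasurable_id, ?_⟩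
    refine ProbabilityMeasure.tendsto_iff_tendsto_charFun.2 fun t => ?_
    have hmain := h.tendsto_integral_sub_uniformMean two_pos hσ
      (fun n ρ => Complex.exp ((t * ((las ρ - 2 / 3 * n) / √n) : ℝ) * Complex.I))
      (A := 3 * |t|) (D := 1) (by positivity) (by norm_num)
      (fun n ρ π => by
        refine (norm_exp_ofReal_mul_I_sub_le _ _).trans ?_
        have e : t * (((las ρ : ℝ) - 2 / 3 * n) / √n) - t * ((las π - 2 / 3 * n) / √n) =
            t * ((las ρ - las π) / √n) := by ring
        have := abs_las_sub_las_le ρ π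
        rw [e, abs_mul, abs_div, abs_of_nonneg (Real.sqrt_nonneg _), ← Real.sqrt_eq_rpow]
        calc |t| * (|(las ρ : ℝ) - las π| / √n) ≤ |t| * (3 * hammingDist ρ π / √n) := by gcongr
          _ = _ := by ring)
      (fun n ρ => (Complex.norm_exp_ofReal_mul_I _).le)
    have hlim := hmain.add (tendsto_uniformMean_exp t)
    simp only [sub_add_cancel, zero_add] at hlim
    simp only [ProbabilityMeasure.coe_mk, Measure.map_id, charFun_gaussianReal]
    have hchar : ∀ n,
        charFun ((P n).map fun ω => ((las (σ n ω) : ℝ) - 2 / 3 * (n : ℝ)) / √(n : ℝ)) t =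
          ∫ ω, Complex.exp ((t * ((las (σ n ω) - 2 / 3 * n) / √n) : ℝ) * Complex.I) ∂(P n) :=
        fun n => by
      rw [charFun_apply_real, integral_map (hmeas n).aemeasurable (by fun_prop)]
      push_cast
      rfl
    simp only [hchar]
    convert hlim using 2
    push_cast
    congr 1
    norm_num
    ring
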